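/- Let $\mathbb H^2$ be the hyperbolic plane, with its hyperbolic area measure $\mathrm{area}$ and its group $\mathrm{Isom}(\mathbb H^2)$ of all isometries. A (nonnegative or signed) Borel measure $\mu$ on $\mathbb H^2\times\mathbb H^2$ is called diagonally invariant if $\mu(gA\times gB)=\mu(A\times B)$ for all measurable $A,B\subset\mathbb H^2$ and all $g\in\mathrm{Isom}(\mathbb H^2)$ (for signed measures: whenever these values are given as finite numbers). (a) Let $\mu$ be a nonnegative diagonally invariant Borel measure on $\mathbb H^2\times\mathbb H^2$ such that $\mu(A\times\mathbb H^2)<\infty$ for some nonempty open set $A\subset\mathbb H^2$. Then $\mu(B\times\mathbb H^2)=\mu(\mathbb H^2\times B)$ for all measurable $B\subset\mathbb H^2$, and there is a constant $c\in[0,\infty)$ such that $\mu(B\times\mathbb H^2)=c\cdot\mathrm{area}(B)$ for all measurable $B\subset\mathbb H^2$. (b) Let $\mu$ be a diagonally invariant Borel signed measure on $\mathbb H^2\times\mathbb H^2$ such that $|\mu|(K\times\mathbb H^2)<\infty$ for every compact $K\subset\mathbb H^2$. Here $\mu$ is a countably additive real-valued function on a family of Borel sets that is closed under finite unions and Borel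 subsets and contains all sets $K\times\mathbb H^2$ with $K$ compact; the upper and lower variations $\mu^{\pm}(E)$ are the suprema of $\pm\mu(F)$ over the sets $F\subset E$ of the family, $|\mu|=\mu^++\mu^-$, and for arbitrary measurable $E$ one puts $\mu(E)=\mu^+(E)-\mu^-(E)\in[-\infty,\infty]$, which is defined unless $\mu^+(E)=\mu^-(E)=\infty$. (So $\mu$ may have infinite total mass of both signs.) Then for all measurable $B\subset\mathbb H^2$, $\mu(B\times\mathbb H^2)$ is defined if and only if $\mu(\mathbb H^2\times B)$ is, and in that case $\mu(B\times\mathbb H^2)=\mu(\mathbb H^2\times B)$. Moreover, there is a constant $c\in\mathbb R$ such that $\mu(B\times\mathbb H^2)=c\cdot\mathrm{area}(B)$ for all measurable $B$ for which the left side is defined (with $0\cdot\infty=0$). If $\mathrm{area}(B)<\infty$, then $|\mu|(B\times\mathbb H^2)<\infty$ and $|\mu|(\mathbb H^2\times B)<\infty$; in particular both values are then defined and finite. -/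

import Mathlib

open MeasureTheory
open scoped UpperHalfPlane NNReal ENNReal

/-! The hyperbolic plane is Mathlib's upper half-plane `ℍ`, with its hyperbolic distance
(curvature `-1`), its Borel σ-algebra and its area measure `volume = dx dy / y ^ 2`.
The isometry group `Isom(ℍ)` is `ℍ ≃ᵢ ℍ`. -/

/-- A (nonnegative) Borel measure on `ℍ × ℍ` is diagonally invariant if
`μ (gA × gB) = μ (A × B)` for all measurable `A`, `B` and every isometry `g`. -/
def DiagonallyInvariant (μ : Measure (ℍ × ℍ)) : Prop :=
  ∀ g : ℍ ≃ᵢ ℍ, ∀ A B : Set ℍ, MeasurableSet A → MeasurableSet B →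
    μ ((g '' A) ×ˢ (g '' B)) = μ (A ×ˢ B)

/-- A signed measure whose positive and negative parts may both have infinite total mass.
It is a countably additive real set function `toFun` on a family `dom` of measurable sets
(those sets on which the measure is given as a finite number), closed under finite unions and
measurable subsets. The values of `toFun` outside `dom` carry no meaning.

Every nonnegative measure, and every extended-real-valued signed measure, gives one, with `dom` the
sets of finite measure; a difference of two nonnegative measures gives one, with `dom` the
sets on which both are finite. -/
structure GenSignedMeasure (α : Type*) [MeasurableSpace α] where
  /-- the sets that have a finite signed measure -/
  dom : Set (Set α)
  /-- the signed measure of a set in `dom` -/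
  toFun : Set α → ℝ
  measurableSet_of_mem : ∀ E ∈ dom, MeasurableSet E
  empty_mem : ∅ ∈ dom
  mem_of_subset : ∀ E ∈ dom, ∀ F, MeasurableSet F → F ⊆ E → F ∈ dom
  union_mem : ∀ E ∈ dom, ∀ F ∈ dom, E ∪ F ∈ dom
  hasSum_iUnion : ∀ f : ℕ → Set α, (∀ i, f i ∈ dom) → Pairwise (Function.onFun Disjoint f) →
    (⋃ i, f i) ∈ dom → HasSum (fun i => toFun (f i)) (toFun (⋃ i, f i))

namespace GenSignedMeasure

variable {α : Type*} [MeasurableSpace α]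

/-- The upper variation `μ⁺ E = sup {μ F : F ⊆ E}`. -/
noncomputable def upperVariation (μ : GenSignedMeasure α) (E : Set α) : ℝ≥0∞ :=
  ⨆ F : {F : Set α // F ∈ μ.dom ∧ F ⊆ E}, ENNReal.ofReal (μ.toFun F)

/-- The lower variation `μ⁻ E = sup {-μ F : F ⊆ E}`. -/
noncomputable def lowerVariation (μ : GenSignedMeasure α) (E : Set α) : ℝ≥0∞ :=
  ⨆ F : {F : Set α // F ∈ μ.dom ∧ F ⊆ E}, ENNReal.ofReal (-μ.toFun F)

/-- The total variation `|μ| E = μ⁺ E + μ⁻ E`. -/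
noncomputable def totalVariation (μ : GenSignedMeasure α) (E : Set α) : ℝ≥0∞ :=
  μ.upperVariation E + μ.lowerVariation E

/-- The value `μ E = μ⁺ E - μ⁻ E` is meaningful: it is not of the form `∞ - ∞`. -/
def IsDefinedOn (μ : GenSignedMeasure α) (E : Set α) : Prop :=
  μ.upperVariation E ≠ ∞ ∨ μ.lowerVariation E ≠ ∞

/-- The value `μ E = μ⁺ E - μ⁻ E` in `[-∞, ∞]`, for a set `E` with `μ.IsDefinedOn E`.
On `dom` it is the given value: see `value_eq` below. -/
noncomputable def value (μ : GenSignedMeasure α) (E : Set α) : EReal :=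
  (μ.upperVariation E : EReal) - (μ.lowerVariation E : EReal)

/-- `μ` is given on `E` as a finite number, and `|μ| E < ∞`. -/
def HasFiniteVariationOn (μ : GenSignedMeasure α) (E : Set α) : Prop :=
  E ∈ μ.dom ∧ μ.totalVariation E < ∞

/-- The restriction of `μ` to a set `E ∈ μ.dom`, as a finite signed measure. -/
noncomputable def trace (μ : GenSignedMeasure α) (E : Set α) (hE : E ∈ μ.dom) :
    SignedMeasure α where
  measureOf' F := by
    classical
    exact if MeasurableSet F then μ.toFun (F ∩ E) else 0
  empty' := by
    have h := μ.hasSum_iUnion (fun _ => ∅) (fun _ => μ.empty_mem)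
      (fun i j _ => by simp [Function.onFun]) (by simpa using μ.empty_mem)
    have h0 := (summable_const_iff (μ.toFun (∅ : Set α))).1 h.summable
    simp [h0]
  not_measurable' F hF := by simp [hF]
  m_iUnion' f hf hd := by
    have hEm := μ.measurableSet_of_mem E hE
    have hU : (⋃ i, f i) ∩ E = ⋃ i, (f i ∩ E) := Set.iUnion_inter _ _
    have h := μ.hasSum_iUnion (fun i => f i ∩ E)
      (fun i => μ.mem_of_subset E hE _ ((hf i).inter hEm) Set.inter_subset_right)
      (fun i j hij => (hd hij).mono Set.inter_subset_left Set.inter_subset_left)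
      (μ.mem_of_subset E hE _ (MeasurableSet.iUnion fun i => (hf i).inter hEm)
        (Set.iUnion_subset fun i => Set.inter_subset_right))
    simpa [hf, MeasurableSet.iUnion hf, hU] using h

lemma trace_apply (μ : GenSignedMeasure α) {E F : Set α} (hE : E ∈ μ.dom) (hF : F ∈ μ.dom)
    (hFE : F ⊆ E) : μ.trace E hE F = μ.toFun F := by
  classical
  have : μ.trace E hE F = if MeasurableSet F then μ.toFun (F ∩ E) else 0 := rfl
  rw [this, if_pos (μ.measurableSet_of_mem F hF), Set.inter_eq_left.2 hFE]

lemma toFun_diff (μ : GenSignedMeasure α) {E F : Set α} (hE : E ∈ μ.dom) (hF : F ∈ μ.dom)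
    (hFE : F ⊆ E) : E \ F ∈ μ.dom ∧ μ.toFun F + μ.toFun (E \ F) = μ.toFun E := by
  have hEm := μ.measurableSet_of_mem E hE
  have hFm := μ.measurableSet_of_mem F hF
  have hD := μ.mem_of_subset E hE _ (hEm.diff hFm) Set.sdiff_subset
  refine ⟨hD, ?_⟩
  have h := VectorMeasure.of_add_of_sdiff (v := μ.trace E hE) hFm hEm hFE
  rwa [trace_apply μ hE hF hFE, trace_apply μ hE hD Set.sdiff_subset,
    trace_apply μ hE hE subset_rfl] at h

/-- On a set of `dom` the total variation is automatically finite. -/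
lemma totalVariation_lt_top (μ : GenSignedMeasure α) {E : Set α} (hE : E ∈ μ.dom) :
    μ.totalVariation E < ∞ := by
  set J := (μ.trace E hE).toJordanDecomposition with hJ
  have key : ∀ F ∈ μ.dom, F ⊆ E → μ.toFun F = J.posPart.real F - J.negPart.real F := by
    intro F hF hFE
    rw [← trace_apply μ hE hF hFE,
      ← SignedMeasure.toSignedMeasure_toJordanDecomposition (μ.trace E hE), ← hJ,
      JordanDecomposition.toSignedMeasure, sub_apply,
      Measure.toSignedMeasure_apply_measurable (μ.measurableSet_of_mem F hF),
      Measure.toSignedMeasure_apply_measurable (μ.measurableSet_of_mem F hF)]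
  refine ENNReal.add_lt_top.2 ⟨?_, ?_⟩
  · refine lt_of_le_of_lt (iSup_le fun F => ?_) (measure_lt_top J.posPart Set.univ)
    rw [key F F.2.1 F.2.2]
    refine le_trans (ENNReal.ofReal_le_ofReal (sub_le_self _ measureReal_nonneg)) ?_
    rw [ofReal_measureReal]
    exact measure_mono (Set.subset_univ _)
  · refine lt_of_le_of_lt (iSup_le fun F => ?_) (measure_lt_top J.negPart Set.univ)
    rw [key F F.2.1 F.2.2, neg_sub]
    refine le_trans (ENNReal.ofReal_le_ofReal (sub_le_self _ measureReal_nonneg)) ?_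
    rw [ofReal_measureReal]
    exact measure_mono (Set.subset_univ _)

/-- On a set of `dom`, the value computed from the variations is the given one. -/
lemma value_eq (μ : GenSignedMeasure α) {E : Set α} (hE : E ∈ μ.dom) :
    μ.value E = (μ.toFun E : EReal) := by
  obtain ⟨hU, hL⟩ := ENNReal.add_lt_top.1 (μ.totalVariation_lt_top hE)
  have u : ∀ F ∈ μ.dom, F ⊆ E → μ.toFun F ≤ (μ.upperVariation E).toReal := fun F hF hFE =>
    (ENNReal.ofReal_le_iff_le_toReal hU.ne).1
      (le_iSup (fun F : {F : Set α // F ∈ μ.dom ∧ F ⊆ E} => ENNReal.ofReal (μ.toFun F))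
        ⟨F, hF, hFE⟩)
  have l : ∀ F ∈ μ.dom, F ⊆ E → -μ.toFun F ≤ (μ.lowerVariation E).toReal := fun F hF hFE =>
    (ENNReal.ofReal_le_iff_le_toReal hL.ne).1
      (le_iSup (fun F : {F : Set α // F ∈ μ.dom ∧ F ⊆ E} => ENNReal.ofReal (-μ.toFun F))
        ⟨F, hF, hFE⟩)
  have h1 : (μ.upperVariation E).toReal ≤ μ.toFun E + (μ.lowerVariation E).toReal := by
    refine ENNReal.toReal_le_of_le_ofReal (by linarith [l E hE subset_rfl]) (iSup_le fun F => ?_)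
    obtain ⟨hD, hadd⟩ := μ.toFun_diff hE F.2.1 F.2.2
    exact ENNReal.ofReal_le_ofReal (by linarith [l _ hD Set.sdiff_subset])
  have h2 : (μ.lowerVariation E).toReal ≤ (μ.upperVariation E).toReal - μ.toFun E := by
    refine ENNReal.toReal_le_of_le_ofReal (by linarith [u E hE subset_rfl]) (iSup_le fun F => ?_)
    obtain ⟨hD, hadd⟩ := μ.toFun_diff hE F.2.1 F.2.2
    exact ENNReal.ofReal_le_ofReal (by linarith [u _ hD Set.sdiff_subset])
  rw [value, ← EReal.coe_toReal (x := (μ.upperVariation E : EReal)) (by simpa using hU.ne)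
    (by simp), ← EReal.coe_toReal (x := (μ.lowerVariation E : EReal)) (by simpa using hL.ne)
    (by simp), ← EReal.coe_sub]
  simp only [EReal.toReal_coe_ennreal]
  congr 1
  linarith

/-- A signed measure on `ℍ × ℍ` is diagonally invariant if `μ (gA × gB) = μ (A × B)` for all
measurable `A`, `B` and every isometry `g`, whenever both sides are given. -/
def DiagonallyInvariant (μ : GenSignedMeasure (ℍ × ℍ)) : Prop :=
  ∀ g : ℍ ≃ᵢ ℍ, ∀ A B : Set ℍ, MeasurableSet A → MeasurableSet B →
    A ×ˢ B ∈ μ.dom → (g '' A) ×ˢ (g '' B) ∈ μ.dom →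
    μ.toFun ((g '' A) ×ˢ (g '' B)) = μ.toFun (A ×ˢ B)

end GenSignedMeasure

open scoped MatrixGroups

/-! For nonnegative `μ`, transitivity of the isometry group makes the mass that each marginal gives
a ball depend only on the radius, and Christensen's lemma (`UniformlyDistributed.exists_eq_smul`)
makes each locally finite marginal a multiple of area. The two constants agree because any two
points can be exchanged by an isometry: `μ` gives `B(x,r) × B(y,r)` and `B(y,r) × B(x,r)` the same
mass, and integrating over `y` yields the area of an `r`-ball times the two marginal masses of
`B(x,r)`. This replaces Haar measure and unimodularity of the group.

In the signed case `μ⁺` is a measure (`exists_measure_eq_upperVariation`) and inherits invariance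
(`upperVariation_image`). The nonnegative case applies to `μ⁺` and to `μ⁻ = (-μ)⁺`; the constant is
the difference of theirs. -/

lemma MeasureTheory.Measure.nnreal_smul_eq_mul {X : Type*} [MeasurableSpace X] (c : ℝ≥0)
    (l : Measure X) (s : Set X) : (c • l) s = (c : ℝ≥0∞) * l s := by
  rw [Measure.smul_apply, ENNReal.smul_def, smul_eq_mul]

/-! ### Uniformly distributed measures on metric spaces -/

section UniformlyDistributed

variable {X : Type*} [MetricSpace X] [MeasurableSpace X]

/-- The measure of a ball depends only on the radius of the ball. -/
def UniformlyDistributed (ν : Measure X) : Prop :=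
  ∀ x y : X, ∀ r : ℝ, ν (Metric.ball x r) = ν (Metric.ball y r)

lemma UniformlyDistributed.ball_ne_zero [SecondCountableTopology X] {ν : Measure X}
    (h : UniformlyDistributed ν) (h0 : ν ≠ 0) (x : X) {r : ℝ} (hr : 0 < r) :
    ν (Metric.ball x r) ≠ 0 := by
  intro hx
  refine h0 (Measure.measure_univ_eq_zero.1 (measure_null_of_locally_null _ fun y _ => ?_))
  exact ⟨Metric.ball y r, mem_nhdsWithin_of_mem_nhds (Metric.ball_mem_nhds y hr), by rw [h y x, hx]⟩

lemma measurableSet_dist_lt [SecondCountableTopology X] [BorelSpace X] (r : ℝ) :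
    MeasurableSet {p : X × X | dist p.1 p.2 < r} :=
  measurableSet_lt measurable_dist measurable_const

lemma lintegral_measure_inter_ball [SecondCountableTopology X] [BorelSpace X] (ν l : Measure X)
    [SFinite ν] [SFinite l] {U V : Set X} (r : ℝ) :
    ∫⁻ x in U, l (V ∩ Metric.ball x r) ∂ν = ∫⁻ y in V, ν (U ∩ Metric.ball y r) ∂l := by
  have h1 : ∀ x, l (V ∩ Metric.ball x r)
      = ∫⁻ y in V, {p : X × X | dist p.1 p.2 < r}.indicator 1 (x, y) ∂l := fun x => by
    have : (fun y => {p : X × X | dist p.1 p.2 < r}.indicator (1 : X × X → ℝ≥0∞) (x, y))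
        = (Metric.ball x r).indicator 1 := by
      ext y; simp [Set.indicator, dist_comm]
    rw [this, lintegral_indicator_one Metric.isOpen_ball.measurableSet,
      Measure.restrict_apply Metric.isOpen_ball.measurableSet, Set.inter_comm]
  have h2 : ∀ y, ν (U ∩ Metric.ball y r)
      = ∫⁻ x in U, {p : X × X | dist p.1 p.2 < r}.indicator 1 (x, y) ∂ν := fun y => by
    have : (fun x => {p : X × X | dist p.1 p.2 < r}.indicator (1 : X × X → ℝ≥0∞) (x, y))
        = (Metric.ball y r).indicator 1 := by
      ext x; simp [Set.indicator]
    rw [this, lintegral_indicator_one Metric.isOpen_ball.measurableSet,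
      Measure.restrict_apply Metric.isOpen_ball.measurableSet, Set.inter_comm]
  simp_rw [h1, h2]
  exact lintegral_lintegral_swap
    ((measurable_one.indicator (measurableSet_dist_lt r)).aemeasurable)

-- At each point `x` of an open `U`, the ratio of `l (U ∩ B(x,r))` to `l (B(o,r))` is eventually 1
-- as `r → 0`. Fatou bounds `ν U` by the liminf of the integrals, and Fubini turns each into an
-- `l`-integral over `U` of `ν (U ∩ B(y,r)) ≤ ν (B(o,r))`. No covering theorem is needed.
open Filter Topology in
lemma UniformlyDistributed.measure_le_liminf [SecondCountableTopology X] [BorelSpace X]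
    [ProperSpace X] {ν l : Measure X} [IsLocallyFiniteMeasure ν] [IsLocallyFiniteMeasure l]
    (hν : UniformlyDistributed ν) (hl : UniformlyDistributed l) (hl0 : l ≠ 0) (o : X)
    {U : Set X} (hU : IsOpen U) (hUt : l U ≠ ∞) :
    ν U ≤ liminf (fun n : ℕ => ν (Metric.ball o (1 / ((n : ℝ) + 1)))
      / l (Metric.ball o (1 / ((n : ℝ) + 1)))) atTop * l U := by
  set r : ℕ → ℝ := fun n => 1 / ((n : ℝ) + 1) with hr
  have hr0 : ∀ n, 0 < r n := fun n => by positivity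
  have hr1 : Tendsto r atTop (𝓝 0) := tendsto_one_div_add_atTop_nhds_zero_nat
  have hmeas : ∀ n, Measurable fun x => l (U ∩ Metric.ball x (r n)) := fun n => by
    have hs := (measurableSet_dist_lt (X := X) (r n)).inter
      (hU.measurableSet.preimage measurable_snd)
    convert measurable_measure_prodMk_left (ν := l) hs using 3 with x
    ext y
    simp [dist_comm, and_comm]
  have hpt : ∀ x ∈ U, (1 : ℝ≥0∞) ≤ liminf (fun n => l (U ∩ Metric.ball x (r n))
      / l (Metric.ball o (r n))) atTop := fun x hx => by
    obtain ⟨ε, hε, hεU⟩ := Metric.isOpen_iff.1 hU x hx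
    refine le_liminf_of_le (by isBoundedDefault) ?_
    filter_upwards [hr1.eventually (gt_mem_nhds hε)] with n hn
    rw [Set.inter_eq_right.2 ((Metric.ball_subset_ball hn.le).trans hεU), hl x o,
      ENNReal.div_self (hl.ball_ne_zero hl0 o (hr0 n)) measure_ball_lt_top.ne]
  calc ν U = ∫⁻ x in U, 1 ∂ν := by simp
    _ ≤ ∫⁻ x in U, liminf (fun n => l (U ∩ Metric.ball x (r n))
          / l (Metric.ball o (r n))) atTop ∂ν := setLIntegral_mono' hU.measurableSet hpt
    _ ≤ liminf (fun n => ∫⁻ x in U, l (U ∩ Metric.ball x (r n))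
          / l (Metric.ball o (r n)) ∂ν) atTop :=
        lintegral_liminf_le fun n => (hmeas n).div_const _
    _ ≤ liminf (fun n => ν (Metric.ball o (r n)) / l (Metric.ball o (r n)) * l U) atTop := by
        refine liminf_le_liminf (Eventually.of_forall fun n => ?_)
          (by isBoundedDefault) (by isBoundedDefault)
        simp only [div_eq_mul_inv]
        rw [lintegral_mul_const _ (hmeas n), lintegral_measure_inter_ball ν l,
          mul_right_comm]
        gcongr
        calc ∫⁻ y in U, ν (U ∩ Metric.ball y (r n)) ∂l
            ≤ ∫⁻ y in U, ν (Metric.ball o (r n)) ∂l :=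
              lintegral_mono fun y => (measure_mono Set.inter_subset_right).trans_eq (hν y o _)
          _ = _ := by simp
    _ = _ := by rw [ENNReal.liminf_mul_const_of_ne_top hUt, mul_comm]

open Filter Topology in
/-- Christensen's lemma: uniformly distributed measures are proportional. -/
lemma UniformlyDistributed.exists_eq_smul [SecondCountableTopology X] [BorelSpace X]
    [ProperSpace X] [Nonempty X] {ν l : Measure X} [IsLocallyFiniteMeasure ν]
    [IsLocallyFiniteMeasure l]
    (hν : UniformlyDistributed ν) (hl : UniformlyDistributed l) (hl0 : l ≠ 0) :
    ∃ c : ℝ≥0, ν = c • l := by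
  rcases eq_or_ne ν 0 with rfl | hν0
  · exact ⟨0, by simp⟩
  obtain ⟨o⟩ := ‹Nonempty X›
  set c := liminf (fun n : ℕ => ν (Metric.ball o (1 / ((n : ℝ) + 1)))
      / l (Metric.ball o (1 / ((n : ℝ) + 1)))) atTop with hc
  set d := liminf (fun n : ℕ => l (Metric.ball o (1 / ((n : ℝ) + 1)))
      / ν (Metric.ball o (1 / ((n : ℝ) + 1)))) atTop with hd
  have h1 : ∀ U, IsOpen U → l U ≠ ∞ → ν U ≤ c * l U := fun U hU hUt =>
    hν.measure_le_liminf hl hl0 o hU hUt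
  have h2 : ∀ U, IsOpen U → ν U ≠ ∞ → l U ≤ d * ν U := fun U hU hUt =>
    hl.measure_le_liminf hν hν0 o hU hUt
  -- The two ratios are reciprocal, so `c⁻¹` is the limsup of the sequence whose liminf is `d`. This
  -- makes the two one-sided bounds match.
  have hdc : d ≤ c⁻¹ := by
    rw [hc, ENNReal.inv_liminf, hd]
    have : (fun n : ℕ => l (Metric.ball o (1 / ((n : ℝ) + 1)))
        / ν (Metric.ball o (1 / ((n : ℝ) + 1)))) = fun n : ℕ =>
        (ν (Metric.ball o (1 / ((n : ℝ) + 1))) / l (Metric.ball o (1 / ((n : ℝ) + 1))))⁻¹ := by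
      ext n
      rw [ENNReal.inv_div (Or.inl measure_ball_lt_top.ne)
        (Or.inl (hl.ball_ne_zero hl0 o (by positivity)))]
    rw [this]
    exact liminf_le_limsup
  have hb := hl.ball_ne_zero hl0 o one_pos
  have hct : c ≠ ∞ := fun h => by
    have := h2 _ (Metric.isOpen_ball (x := o) (ε := 1)) measure_ball_lt_top.ne
    rw [h, ENNReal.inv_top, nonpos_iff_eq_zero] at hdc
    rw [hdc, zero_mul] at this
    exact hb (nonpos_iff_eq_zero.1 this)
  refine ⟨c.toNNReal, Measure.OuterRegular.ext_isOpen_isBounded fun U hU hUb => ?_⟩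
  have e : (c.toNNReal • l) U = c * l U := by
    rw [Measure.nnreal_smul_eq_mul, ENNReal.coe_toNNReal hct]
  rw [e]
  refine le_antisymm (h1 U hU hUb.measure_lt_top.ne) ?_
  calc c * l U ≤ c * (c⁻¹ * ν U) := by
        gcongr
        exact (h2 U hU hUb.measure_lt_top.ne).trans (by gcongr)
    _ = (c * c⁻¹) * ν U := (mul_assoc ..).symm
    _ ≤ 1 * ν U := by gcongr; exact ENNReal.mul_inv_le_one c
    _ = ν U := one_mul _

end UniformlyDistributed

/-! ### Isometries and area of the hyperbolic plane -/

namespace UpperHalfPlane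

lemma exists_isometryEquiv_map_eq (x y : ℍ) : ∃ g : ℍ ≃ᵢ ℍ, g x = y := by
  obtain ⟨g, hg⟩ := MulAction.exists_smul_eq SL(2, ℝ) x y
  exact ⟨IsometryEquiv.constSMul g, hg⟩

lemma exists_isometryEquiv_swap_I (w : ℍ) : ∃ g : ℍ ≃ᵢ ℍ, g I = w ∧ g w = I := by
  set v := w.re with hv
  set q := w.im with hq
  have hq0 : 0 < q := w.im_pos
  set d := q * ((1 + q) ^ 2 + v ^ 2) with hd
  have hd0 : 0 < d := by positivity
  set s := √d with hs
  have hs0 : s ≠ 0 := (Real.sqrt_pos.2 hd0).ne'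
  have hs2 : s * s = d := Real.mul_self_sqrt hd0.le
  -- Trace zero makes the Möbius map an involution, the half-turn about the midpoint of `I` and `w`.
  -- The entries solve `M • I = w`, and `s` normalizes the determinant.
  let M : SL(2, ℝ) := ⟨!![v / s, (-q * (1 + q) - v ^ 2) / s; (1 + q) / s, -v / s], by
    rw [Matrix.det_fin_two_of]
    field_simp
    rw [sq s, hs2, hd]
    ring⟩
  have hM : ∀ z z' : ℍ, (v * (z : ℂ) + (-q * (1 + q) - v ^ 2)) = z' * ((1 + q) * z - v) →
      M • z = z' := fun z z' h => by
    apply UpperHalfPlane.ext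
    rw [coe_specialLinearGroup_apply]
    have hden : ((1 + q : ℝ) : ℂ) * z - v ≠ 0 := fun h0 => by
      have := congrArg Complex.im h0
      simp [z.im_ne_zero] at this
      linarith
    have hs0' : (s : ℂ) ≠ 0 := by exact_mod_cast hs0
    simp only [M, Matrix.of_apply, Matrix.cons_val',
      Matrix.cons_val_zero, Matrix.cons_val_one, Matrix.cons_val_fin_one,
      Algebra.algebraMap_self, RingHom.id_apply]
    push_cast at hden ⊢
    rw [div_eq_iff]
    · field_simp
      linear_combination h
    · intro h0
      apply hden
      field_simp at h0
      linear_combination h0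
  have hw : (w : ℂ) = v + q * Complex.I := by
    apply Complex.ext <;> simp [hv, hq]
  refine ⟨IsometryEquiv.constSMul M, hM I w ?_, hM w I ?_⟩
  · rw [coe_I, hw]
    linear_combination (-(q : ℂ) - q ^ 2) * Complex.I_sq
  · rw [coe_I, hw]
    linear_combination (-(q : ℂ) - q ^ 2) * Complex.I_sq

/-- Any two points of the hyperbolic plane can be exchanged by an isometry. -/
lemma exists_isometryEquiv_swap (x y : ℍ) : ∃ g : ℍ ≃ᵢ ℍ, g x = y ∧ g y = x := by
  obtain ⟨h, hx⟩ := exists_isometryEquiv_map_eq x I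
  obtain ⟨g, h1, h2⟩ := exists_isometryEquiv_swap_I (h y)
  refine ⟨(h.trans g).trans h.symm, ?_, ?_⟩
  · simp [hx, h1]
  · simp [h2, ← hx]

lemma uniformlyDistributed_volume : UniformlyDistributed (volume : Measure ℍ) := by
  intro x y r
  obtain ⟨g, rfl⟩ := MulAction.exists_smul_eq SL(2, ℝ) x y
  rw [← Metric.smul_ball]
  exact (measure_smul volume (g : GL (Fin 2) ℝ) (Metric.ball x r)).symm

lemma volume_ne_zero : (volume : Measure ℍ) ≠ 0 := by
  intro h
  have h1 : volume (Set.univ : Set ℍ) = 0 := by rw [h]; simp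
  rw [volume_eq_lintegral] at h1
  have hm : MeasurableSet ((↑) '' (Set.univ : Set ℍ) : Set ℂ) :=
    measurableEmbedding_coe.measurableSet_image.2 MeasurableSet.univ
  rw [setLIntegral_eq_zero_iff hm (by fun_prop)] at h1
  have h2 : volume ((↑) '' (Set.univ : Set ℍ) : Set ℂ) = 0 := by
    refine measure_mono_null ?_ h1
    rintro _ ⟨z, hz, rfl⟩ h'
    have := h' ⟨z, hz, rfl⟩
    simp [z.im_ne_zero] at this
  rw [Set.image_univ, (isOpenEmbedding_coe.isOpen_range.measure_eq_zero_iff volume)] at h2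
  exact (Set.range_nonempty ((↑) : ℍ → ℂ)).ne_empty h2

end UpperHalfPlane

/-! ### Mass transport for nonnegative measures -/

section Nonneg

open UpperHalfPlane

variable {μ : Measure (ℍ × ℍ)}

lemma isLocallyFiniteMeasure_of_ball {ν : Measure ℍ} (h : UniformlyDistributed ν)
    {x : ℍ} {r : ℝ} (hr : 0 < r) (hx : ν (Metric.ball x r) < ∞) : IsLocallyFiniteMeasure ν :=
  ⟨fun y => ⟨Metric.ball y r, Metric.ball_mem_nhds y hr, by rwa [h y x]⟩⟩

lemma DiagonallyInvariant.uniformlyDistributed_fst (h : DiagonallyInvariant μ) :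
    UniformlyDistributed (μ.map Prod.fst) := by
  intro x y r
  obtain ⟨g, rfl⟩ := exists_isometryEquiv_map_eq x y
  have := h g (Metric.ball x r) Set.univ Metric.isOpen_ball.measurableSet MeasurableSet.univ
  rw [g.image_ball, Set.image_univ, g.surjective.range_eq] at this
  rw [Measure.map_apply measurable_fst Metric.isOpen_ball.measurableSet,
    Measure.map_apply measurable_fst Metric.isOpen_ball.measurableSet, ← Set.prod_univ,
    ← Set.prod_univ, this]

lemma DiagonallyInvariant.uniformlyDistributed_snd (h : DiagonallyInvariant μ) :
    UniformlyDistributed (μ.map Prod.snd) := by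
  intro x y r
  obtain ⟨g, rfl⟩ := exists_isometryEquiv_map_eq x y
  have := h g Set.univ (Metric.ball x r) MeasurableSet.univ Metric.isOpen_ball.measurableSet
  rw [g.image_ball, Set.image_univ, g.surjective.range_eq] at this
  rw [Measure.map_apply measurable_snd Metric.isOpen_ball.measurableSet,
    Measure.map_apply measurable_snd Metric.isOpen_ball.measurableSet, ← Set.univ_prod,
    ← Set.univ_prod, this]

lemma DiagonallyInvariant.ball_prod_ball (h : DiagonallyInvariant μ) (x y : ℍ) (r : ℝ) :
    μ (Metric.ball x r ×ˢ Metric.ball y r) = μ (Metric.ball y r ×ˢ Metric.ball x r) := by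
  obtain ⟨g, h1, h2⟩ := exists_isometryEquiv_swap x y
  have := h g (Metric.ball x r) (Metric.ball y r) Metric.isOpen_ball.measurableSet
    Metric.isOpen_ball.measurableSet
  rw [g.image_ball, g.image_ball, h1, h2] at this
  exact this.symm

/-- By Fubini, each `p` in `S` is counted with weight the area of the set of `y` within `r` of `f
p`, a ball whose area does not depend on `p`. -/
lemma lintegral_measure_inter_preimage_ball [SFinite μ] {f : ℍ × ℍ → ℍ} (hf : Measurable f)
    {S : Set (ℍ × ℍ)} (r : ℝ) (o : ℍ) :
    ∫⁻ y : ℍ, μ (S ∩ f ⁻¹' Metric.ball y r) = volume (Metric.ball o r) * μ S := by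
  have hm : Measurable fun p : ℍ × (ℍ × ℍ) =>
      {p : ℍ × ℍ | dist p.1 p.2 < r}.indicator (1 : ℍ × ℍ → ℝ≥0∞) (f p.2, p.1) :=
    (measurable_one.indicator (measurableSet_dist_lt r)).comp
      ((hf.comp measurable_snd).prodMk measurable_fst)
  calc ∫⁻ y : ℍ, μ (S ∩ f ⁻¹' Metric.ball y r)
      = ∫⁻ y : ℍ, ∫⁻ p in S,
          {p : ℍ × ℍ | dist p.1 p.2 < r}.indicator (1 : ℍ × ℍ → ℝ≥0∞) (f p, y) ∂μ := by
        refine lintegral_congr fun y => ?_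
        have e : (fun p => {p : ℍ × ℍ | dist p.1 p.2 < r}.indicator (1 : ℍ × ℍ → ℝ≥0∞) (f p, y))
            = (f ⁻¹' Metric.ball y r).indicator 1 := by
          ext p; simp [Set.indicator]
        have hb := hf (Metric.isOpen_ball (x := y) (ε := r)).measurableSet
        rw [e, lintegral_indicator_one hb, Measure.restrict_apply hb, Set.inter_comm]
    _ = ∫⁻ p in S, ∫⁻ y : ℍ,
          {p : ℍ × ℍ | dist p.1 p.2 < r}.indicator (1 : ℍ × ℍ → ℝ≥0∞) (f p, y) ∂volume ∂μ :=
        lintegral_lintegral_swap hm.aemeasurable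
    _ = ∫⁻ p in S, volume (Metric.ball o r) ∂μ := by
        refine lintegral_congr fun p => ?_
        have e : (fun y => {p : ℍ × ℍ | dist p.1 p.2 < r}.indicator (1 : ℍ × ℍ → ℝ≥0∞) (f p, y))
            = (Metric.ball (f p) r).indicator 1 := by
          ext y; simp [Set.indicator, dist_comm]
        rw [e, lintegral_indicator_one Metric.isOpen_ball.measurableSet,
          uniformlyDistributed_volume]
    _ = _ := by simp

/-- The exchange of two balls, averaged over the second centre; the common factor cancels because a
ball has positive finite area. -/
lemma DiagonallyInvariant.ball_prod_univ [SFinite μ] (h : DiagonallyInvariant μ) (x : ℍ) {r : ℝ}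
    (hr : 0 < r) : μ (Metric.ball x r ×ˢ Set.univ) = μ (Set.univ ×ˢ Metric.ball x r) := by
  have h1 := lintegral_measure_inter_preimage_ball (μ := μ) measurable_snd
    (S := Metric.ball x r ×ˢ Set.univ) r x
  have h2 := lintegral_measure_inter_preimage_ball (μ := μ) measurable_fst
    (S := Set.univ ×ˢ Metric.ball x r) r x
  have h3 : ∀ y : ℍ, μ (Metric.ball x r ×ˢ Set.univ ∩ Prod.snd ⁻¹' Metric.ball y r)
      = μ (Set.univ ×ˢ Metric.ball x r ∩ Prod.fst ⁻¹' Metric.ball y r) := fun y => by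
    rw [← Set.univ_prod, ← Set.prod_univ, Set.prod_inter_prod, Set.prod_inter_prod]
    simpa using h.ball_prod_ball x y r
  simp_rw [h3] at h1
  rw [h1] at h2
  exact (ENNReal.mul_right_inj (uniformlyDistributed_volume.ball_ne_zero volume_ne_zero x hr)
    measure_ball_lt_top.ne).1 h2

/-- The mass transport principle in the hyperbolic plane. -/
theorem DiagonallyInvariant.marginals_eq_smul_volume (h : DiagonallyInvariant μ)
    (hA : ∃ A : Set ℍ, IsOpen A ∧ A.Nonempty ∧ μ (A ×ˢ Set.univ) < ∞) :
    ∃ c : ℝ≥0, ∀ B : Set ℍ, MeasurableSet B → μ (B ×ˢ Set.univ) = (c : ℝ≥0∞) * volume B ∧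
      μ (Set.univ ×ˢ B) = (c : ℝ≥0∞) * volume B := by
  obtain ⟨A, hA, ⟨x, hx⟩, hfin⟩ := hA
  obtain ⟨r, hr, hrA⟩ := Metric.isOpen_iff.1 hA x hx
  have hf : ∀ B : Set ℍ, MeasurableSet B → μ.map Prod.fst B = μ (B ×ˢ Set.univ) :=
    fun B hB => by rw [Measure.map_apply measurable_fst hB, Set.prod_univ]
  have hs : ∀ B : Set ℍ, MeasurableSet B → μ.map Prod.snd B = μ (Set.univ ×ˢ B) :=
    fun B hB => by rw [Measure.map_apply measurable_snd hB, Set.univ_prod]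
  have hb : MeasurableSet (Metric.ball x r) := Metric.isOpen_ball.measurableSet
  have hxr : μ (Metric.ball x r ×ˢ Set.univ) < ∞ :=
    (measure_mono (Set.prod_mono_left hrA)).trans_lt hfin
  have : IsLocallyFiniteMeasure (μ.map Prod.fst) :=
    isLocallyFiniteMeasure_of_ball h.uniformlyDistributed_fst hr (by rwa [hf _ hb])
  have : SigmaFinite μ := SigmaFinite.of_map μ measurable_fst.aemeasurable inferInstance
  have hbu := h.ball_prod_univ x hr
  -- Finiteness is assumed for the first marginal only; equality on one ball transfers it to the
  -- second.
  have : IsLocallyFiniteMeasure (μ.map Prod.snd) :=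
    isLocallyFiniteMeasure_of_ball h.uniformlyDistributed_snd hr (by rwa [hs _ hb, ← hbu])
  obtain ⟨c, hc⟩ :=
    h.uniformlyDistributed_fst.exists_eq_smul uniformlyDistributed_volume volume_ne_zero
  obtain ⟨d, hd⟩ :=
    h.uniformlyDistributed_snd.exists_eq_smul uniformlyDistributed_volume volume_ne_zero
  have hcd : c = d := by
    rw [← hf _ hb, ← hs _ hb, hc, hd, Measure.nnreal_smul_eq_mul, Measure.nnreal_smul_eq_mul,
      ENNReal.mul_left_inj (uniformlyDistributed_volume.ball_ne_zero volume_ne_zero x hr)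
        measure_ball_lt_top.ne] at hbu
    exact_mod_cast hbu
  refine ⟨c, fun B hB => ⟨?_, ?_⟩⟩
  · rw [← hf B hB, hc, Measure.nnreal_smul_eq_mul]
  · rw [← hs B hB, hd, Measure.nnreal_smul_eq_mul, hcd]

end Nonneg

namespace GenSignedMeasure

open Filter Topology

/-! ### The upper variation as a measure -/

section Variation

variable {α : Type*} [MeasurableSpace α] (μ : GenSignedMeasure α)

/-- The signed measure `-μ`. -/
def neg : GenSignedMeasure α where
  dom := μ.dom
  toFun E := -μ.toFun E
  measurableSet_of_mem := μ.measurableSet_of_mem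
  empty_mem := μ.empty_mem
  mem_of_subset := μ.mem_of_subset
  union_mem := μ.union_mem
  hasSum_iUnion f hf hd hU := (μ.hasSum_iUnion f hf hd hU).neg

lemma upperVariation_neg (E : Set α) : μ.neg.upperVariation E = μ.lowerVariation E := rfl

variable {μ}

lemma trace_apply_inter {E F : Set α} (hE : E ∈ μ.dom) (hF : MeasurableSet F) :
    μ.trace E hE F = μ.toFun (F ∩ E) := by
  classical
  have : μ.trace E hE F = if MeasurableSet F then μ.toFun (F ∩ E) else 0 := rfl
  rw [this, if_pos hF]

lemma toFun_union {E F : Set α} (hE : E ∈ μ.dom) (hF : F ∈ μ.dom) (h : Disjoint E F) :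
    μ.toFun (E ∪ F) = μ.toFun E + μ.toFun F := by
  have := (μ.toFun_diff (μ.union_mem E hE F hF) hE Set.subset_union_left).2
  rwa [Set.union_sdiff_cancel_left h.le_bot, eq_comm] at this

lemma ofReal_toFun_le_upperVariation {E F : Set α} (hF : F ∈ μ.dom) (h : F ⊆ E) :
    ENNReal.ofReal (μ.toFun F) ≤ μ.upperVariation E :=
  le_iSup (fun F : {F : Set α // F ∈ μ.dom ∧ F ⊆ E} => ENNReal.ofReal (μ.toFun F)) ⟨F, hF, h⟩

lemma tendsto_toFun_inter {C : ℕ → Set α} (hC : Monotone C) (hCm : ∀ n, MeasurableSet (C n))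
    (hU : ⋃ n, C n = Set.univ) {F : Set α} (hF : F ∈ μ.dom) :
    Tendsto (fun n => μ.toFun (F ∩ C n)) atTop (𝓝 (μ.toFun F)) := by
  have h := VectorMeasure.tendsto_vectorMeasure_iUnion_atTop_nat (v := μ.trace F hF) hC hCm
  rw [hU, trace_apply_inter hF MeasurableSet.univ, Set.univ_inter] at h
  refine h.congr fun n => ?_
  rw [trace_apply_inter hF (hCm n), Set.inter_comm]

/-- `H` is a positive set of a Hahn decomposition of the trace. The positive part is thus attained
by `μ` on a subset of `E`, which allows comparison with the supremum. -/
lemma exists_posPart_eq {E : Set α} (hE : E ∈ μ.dom) : ∃ H, MeasurableSet H ∧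
    ∀ F, MeasurableSet F → (μ.trace E hE).toJordanDecomposition.posPart F
      = ENNReal.ofReal (μ.toFun (F ∩ H ∩ E)) ∧ 0 ≤ μ.toFun (F ∩ H ∩ E) := by
  obtain ⟨H, hH, hH0, -, hpos, -⟩ := (μ.trace E hE).toJordanDecomposition_spec
  refine ⟨H, hH, fun F hF => ⟨?_, ?_⟩⟩
  on_goal 2 =>
    rw [← trace_apply_inter hE (hF.inter hH)]
    exact VectorMeasure.nonneg_of_zero_le_restrict _
      (VectorMeasure.zero_le_restrict_subset _ hH Set.inter_subset_right hH0)
  rw [hpos, SignedMeasure.toMeasureOfZeroLE_apply _ hH0 hH hF, ← ENNReal.ofReal_eq_coe_nnreal,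
    trace_apply_inter hE (hH.inter hF), Set.inter_comm H F]

lemma toFun_inter_le_posPart {E F G : Set α} (hE : E ∈ μ.dom) (hF : MeasurableSet F)
    (hFG : F ⊆ G) :
    μ.toFun (F ∩ E) ≤ (μ.trace E hE).toJordanDecomposition.posPart.real G := by
  rw [← trace_apply_inter hE hF, SignedMeasure.apply_eq_posPart_real_sub_negPart_real _ hF]
  exact (sub_le_self _ measureReal_nonneg).trans (measureReal_mono hFG)

/-- If the space is a countable union of sets on which `μ` is given, then the upper variation
is a measure. -/
lemma exists_measure_eq_upperVariation {S : ℕ → Set α} (hS : ∀ n, S n ∈ μ.dom)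
    (hd : Pairwise (Function.onFun Disjoint S)) (hU : ⋃ n, S n = Set.univ) :
    ∃ P : Measure α, ∀ E, MeasurableSet E → P E = μ.upperVariation E := by
  have hSm := fun n => μ.measurableSet_of_mem _ (hS n)
  refine ⟨Measure.sum fun n => (μ.trace (S n) (hS n)).toJordanDecomposition.posPart,
    fun E hE => ?_⟩
  rw [Measure.sum_apply _ hE]
  refine le_antisymm ?_ (iSup_le fun ⟨F, hF, hFE⟩ => ?_)
  -- `dom` is closed only under finite unions, so the Hahn-positive pieces are united up to `n`,
  -- bounding the partial sums.
  · choose H hHm hH using fun n => exists_posPart_eq (hS n)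
    have hmem : ∀ n, E ∩ H n ∩ S n ∈ μ.dom := fun n =>
      μ.mem_of_subset _ (hS n) _ ((hE.inter (hHm n)).inter (hSm n)) Set.inter_subset_right
    have key : ∀ n, ∃ F ∈ μ.dom, F ⊆ E ∩ ⋃ k < n, S k ∧ ENNReal.ofReal (μ.toFun F) =
        ∑ k ∈ Finset.range n, (μ.trace (S k) (hS k)).toJordanDecomposition.posPart E ∧
        0 ≤ μ.toFun F := by
      intro n
      induction n with
      | zero =>
        have h0 : μ.toFun ∅ = 0 := by
          have := toFun_union μ.empty_mem μ.empty_mem disjoint_bot_left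
          simpa using this
        exact ⟨∅, μ.empty_mem, Set.empty_subset _, by simp [h0], h0.ge⟩
      | succ n ih =>
        obtain ⟨F, hF, hFE, hsum, hF0⟩ := ih
        have hdisj : Disjoint F (E ∩ H n ∩ S n) := by
          refine Set.disjoint_left.2 fun x hx hx' => ?_
          obtain ⟨k, hk, hxk⟩ := Set.mem_iUnion₂.1 (hFE hx).2
          exact Set.disjoint_left.1 (hd hk.ne) hxk hx'.2
        have hnn := (hH n E hE).2
        refine ⟨F ∪ (E ∩ H n ∩ S n), μ.union_mem _ hF _ (hmem n), ?_, ?_, ?_⟩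
        · refine Set.union_subset (hFE.trans ?_) fun x hx => ⟨hx.1.1, ?_⟩
          · exact Set.inter_subset_inter_right _
              (Set.biUnion_subset_biUnion_left fun k hk => Nat.lt_succ_of_lt hk)
          · exact Set.mem_iUnion₂.2 ⟨n, n.lt_succ_self, hx.2⟩
        · rw [toFun_union hF (hmem n) hdisj, ENNReal.ofReal_add hF0 hnn, hsum,
            Finset.sum_range_succ, (hH n E hE).1]
        · rw [toFun_union hF (hmem n) hdisj]
          exact add_nonneg hF0 hnn
    refine ENNReal.tsum_le_of_sum_range_le fun n => ?_
    obtain ⟨F, hF, hFE, hsum, -⟩ := key n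
    rw [← hsum]
    exact ofReal_toFun_le_upperVariation hF (hFE.trans Set.inter_subset_left)
  · have hFm := μ.measurableSet_of_mem F hF
    have hFU : ⋃ n, F ∩ S n = F := by rw [← Set.inter_iUnion, hU, Set.inter_univ]
    have h := μ.hasSum_iUnion (fun n => F ∩ S n)
      (fun n => μ.mem_of_subset F hF _ (hFm.inter (hSm n)) Set.inter_subset_left)
      (fun i j hij => (hd hij).mono Set.inter_subset_right Set.inter_subset_right)
      (by rwa [hFU])
    rw [hFU] at h
    refine le_of_tendsto (ENNReal.tendsto_ofReal h.tendsto_sum_nat) (.of_forall fun n => ?_)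
    calc ENNReal.ofReal (∑ k ∈ Finset.range n, μ.toFun (F ∩ S k))
        ≤ ENNReal.ofReal (∑ k ∈ Finset.range n,
            (μ.trace (S k) (hS k)).toJordanDecomposition.posPart.real E) := by
          gcongr with k
          exact toFun_inter_le_posPart (hS k) hFm hFE
      _ = ∑ k ∈ Finset.range n, (μ.trace (S k) (hS k)).toJordanDecomposition.posPart E := by
          rw [ENNReal.ofReal_sum_of_nonneg fun _ _ => measureReal_nonneg]
          exact Finset.sum_congr rfl fun k _ => ofReal_measureReal
      _ ≤ _ := ENNReal.sum_le_tsum _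

end Variation

/-! ### Mass transport for signed measures -/

section Hyperbolic

variable {μ : GenSignedMeasure (ℍ × ℍ)}

lemma DiagonallyInvariant.neg (h : μ.DiagonallyInvariant) : μ.neg.DiagonallyInvariant :=
  fun g A B hA hB h1 h2 => congrArg Neg.neg (h g A B hA hB h1 h2)

lemma prod_univ_mem_dom (hK : ∀ K : Set ℍ, IsCompact K → K ×ˢ Set.univ ∈ μ.dom) {K : Set ℍ}
    (hKc : IsCompact K) {F : Set (ℍ × ℍ)} (hF : MeasurableSet F) (hFK : F ⊆ K ×ˢ Set.univ) :
    F ∈ μ.dom :=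
  μ.mem_of_subset _ (hK K hKc) F hF hFK

/-- Invariance is given on rectangles only. Over `K` and over its image under `g` the traces are
finite signed measures, so agreement on the π-system of rectangles extends to all measurable sets.
-/
lemma DiagonallyInvariant.toFun_image (h : μ.DiagonallyInvariant)
    (hK : ∀ K : Set ℍ, IsCompact K → K ×ˢ Set.univ ∈ μ.dom) (g : ℍ ≃ᵢ ℍ) {K : Set ℍ}
    (hKc : IsCompact K) {F : Set (ℍ × ℍ)} (hF : MeasurableSet F) (hFK : F ⊆ K ×ˢ Set.univ) :
    μ.toFun (Prod.map g g '' F) = μ.toFun F := by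
  have hgm : ∀ A : Set ℍ, MeasurableSet A → MeasurableSet (g '' A) := fun A hA =>
    g.toHomeomorph.measurableEmbedding.measurableSet_image.2 hA
  have hgK : IsCompact (g '' K) := hKc.image g.continuous
  have him : ∀ E : Set (ℍ × ℍ), Prod.map g.symm g.symm ⁻¹' E = Prod.map g g '' E := fun E => by
    refine (congrFun (Set.image_eq_preimage_of_inverse ?_ ?_) E).symm <;> intro p <;>
      exact Prod.ext (by simp) (by simp)
  have hsm : Measurable (Prod.map g.symm g.symm : ℍ × ℍ → ℍ × ℍ) :=
    g.symm.continuous.measurable.prodMap g.symm.continuous.measurable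
  have key : μ.trace _ (hK K hKc)
      = (μ.trace _ (hK _ hgK)).map (Prod.map g.symm g.symm) := by
    have hrect : ∀ A B : Set ℍ, MeasurableSet A → MeasurableSet B →
        μ.trace _ (hK K hKc) (A ×ˢ B)
          = (μ.trace _ (hK _ hgK)).map (Prod.map g.symm g.symm) (A ×ˢ B) := by
      intro A B hA hB
      rw [VectorMeasure.map_apply _ hsm (hA.prod hB), him, Set.prodMap_image_prod,
        trace_apply_inter _ (hA.prod hB), trace_apply_inter _ ((hgm A hA).prod (hgm B hB)),
        Set.prod_inter_prod, Set.prod_inter_prod, Set.inter_univ, Set.inter_univ,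
        ← Set.image_inter g.injective]
      have hAK := hA.inter hKc.measurableSet
      exact (h g _ _ hAK hB
        (prod_univ_mem_dom hK hKc (hAK.prod hB)
          (Set.prod_mono Set.inter_subset_right (Set.subset_univ _)))
        (prod_univ_mem_dom hK hgK ((hgm _ hAK).prod (hgm B hB))
          (Set.prod_mono (Set.image_mono Set.inter_subset_right) (Set.subset_univ _)))).symm
    refine VectorMeasure.ext_of_generateFrom _ ?_ generateFrom_prod.symm isPiSystem_prod ?_
    · rintro _ ⟨A, hA, B, hB, rfl⟩
      exact hrect A B hA hB
    · rw [← Set.univ_prod_univ]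
      exact hrect _ _ MeasurableSet.univ MeasurableSet.univ
  have := congrArg (fun v => v F) key
  beta_reduce at this
  rw [VectorMeasure.map_apply _ hsm hF, trace_apply_inter _ hF, trace_apply_inter _ (hsm hF),
    him, Set.inter_eq_left.2 hFK, Set.inter_eq_left.2] at this
  · exact this.symm
  · rintro _ ⟨p, hp, rfl⟩
    exact ⟨Set.mem_image_of_mem g (hFK hp).1, Set.mem_univ _⟩

lemma monotone_closedBall_prod_univ : Monotone fun n : ℕ =>
    Metric.closedBall UpperHalfPlane.I (n : ℝ) ×ˢ (Set.univ : Set ℍ) := fun _ _ h =>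
  Set.prod_mono_left (Metric.closedBall_subset_closedBall (by exact_mod_cast h))

lemma iUnion_closedBall_prod_univ : ⋃ n : ℕ,
    Metric.closedBall UpperHalfPlane.I (n : ℝ) ×ˢ (Set.univ : Set ℍ) = Set.univ := by
  rw [← Set.iUnion_prod_const, Metric.iUnion_closedBall_nat, Set.univ_prod_univ]

lemma measurableSet_closedBall_prod_univ (n : ℕ) : MeasurableSet
    (Metric.closedBall UpperHalfPlane.I (n : ℝ) ×ˢ (Set.univ : Set ℍ)) :=
  Metric.isClosed_closedBall.measurableSet.prod MeasurableSet.univ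

/-- The image of a set of `dom` need not lie in `dom`. Cutting with closed balls in the first factor
brings it there, and countable additivity recovers the value in the limit. -/
lemma DiagonallyInvariant.upperVariation_le_image (h : μ.DiagonallyInvariant)
    (hK : ∀ K : Set ℍ, IsCompact K → K ×ˢ Set.univ ∈ μ.dom) (g : ℍ ≃ᵢ ℍ) (E : Set (ℍ × ℍ)) :
    μ.upperVariation E ≤ μ.upperVariation (Prod.map g g '' E) := by
  refine iSup_le fun ⟨F, hF, hFE⟩ => ?_
  have hFm := μ.measurableSet_of_mem F hF
  refine le_of_tendsto (ENNReal.tendsto_ofReal (tendsto_toFun_inter monotone_closedBall_prod_univ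
    measurableSet_closedBall_prod_univ iUnion_closedBall_prod_univ hF)) (.of_forall fun n => ?_)
  have hm := hFm.inter (measurableSet_closedBall_prod_univ n)
  have hc := isCompact_closedBall UpperHalfPlane.I (n : ℝ)
  rw [← h.toFun_image hK g hc hm Set.inter_subset_right]
  refine ofReal_toFun_le_upperVariation (prod_univ_mem_dom hK (hc.image g.continuous) ?_ ?_)
    (Set.image_mono (Set.inter_subset_left.trans hFE))
  · exact (g.toHomeomorph.prodCongr g.toHomeomorph).measurableEmbedding.measurableSet_image.2 hm
  · rintro _ ⟨p, hp, rfl⟩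
    exact ⟨Set.mem_image_of_mem g hp.2.1, Set.mem_univ _⟩

lemma DiagonallyInvariant.upperVariation_image (h : μ.DiagonallyInvariant)
    (hK : ∀ K : Set ℍ, IsCompact K → K ×ˢ Set.univ ∈ μ.dom) (g : ℍ ≃ᵢ ℍ) (E : Set (ℍ × ℍ)) :
    μ.upperVariation (Prod.map g g '' E) = μ.upperVariation E := by
  refine le_antisymm ?_ (h.upperVariation_le_image hK g E)
  refine (h.upperVariation_le_image hK g.symm _).trans_eq ?_
  rw [← Set.image_comp, Prod.map_comp_map, g.symm_comp_self, Prod.map_id, Set.image_id]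

/-- The mass transport principle for the upper variation. -/
lemma DiagonallyInvariant.exists_upperVariation_eq (h : μ.DiagonallyInvariant)
    (hK : ∀ K : Set ℍ, IsCompact K → μ.HasFiniteVariationOn (K ×ˢ Set.univ)) :
    ∃ c : ℝ≥0, ∀ B : Set ℍ, MeasurableSet B →
      μ.upperVariation (B ×ˢ Set.univ) = (c : ℝ≥0∞) * volume B ∧
      μ.upperVariation (Set.univ ×ˢ B) = (c : ℝ≥0∞) * volume B := by
  have hK' := fun K hKc => (hK K hKc).1
  obtain ⟨P, hP⟩ := μ.exists_measure_eq_upperVariation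
    -- Annuli around `I` times the plane form a countable partition into sets of `dom`.
    (S := disjointed fun n : ℕ => Metric.closedBall UpperHalfPlane.I (n : ℝ) ×ˢ Set.univ)
    (fun n => prod_univ_mem_dom hK' (isCompact_closedBall UpperHalfPlane.I (n : ℝ))
      (MeasurableSet.disjointed measurableSet_closedBall_prod_univ n) (disjointed_subset _ n))
    (disjoint_disjointed _) (by rw [iUnion_disjointed, iUnion_closedBall_prod_univ])
  have hinv : _root_.DiagonallyInvariant P := fun g A B hA hB => by
    have hgm : ∀ A : Set ℍ, MeasurableSet A → MeasurableSet (g '' A) := fun A hA =>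
      g.toHomeomorph.measurableEmbedding.measurableSet_image.2 hA
    rw [hP _ (hA.prod hB), hP _ ((hgm A hA).prod (hgm B hB)), ← Set.prodMap_image_prod,
      h.upperVariation_image hK']
  obtain ⟨c, hc⟩ := hinv.marginals_eq_smul_volume
    ⟨Metric.ball UpperHalfPlane.I 1, Metric.isOpen_ball, ⟨_, Metric.mem_ball_self one_pos⟩, by
      refine (measure_mono (Set.prod_mono_left Metric.ball_subset_closedBall)).trans_lt ?_
      rw [hP _ (Metric.isClosed_closedBall.measurableSet.prod MeasurableSet.univ)]
      exact (ENNReal.add_lt_top.1 (hK _ (isCompact_closedBall _ _)).2).1⟩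
  refine ⟨c, fun B hB => ?_⟩
  rw [← hP _ (hB.prod MeasurableSet.univ), ← hP _ (MeasurableSet.univ.prod hB)]
  exact hc B hB

lemma HasFiniteVariationOn.neg {E : Set (ℍ × ℍ)} (h : μ.HasFiniteVariationOn E) :
    μ.neg.HasFiniteVariationOn E :=
  ⟨h.1, totalVariation_lt_top μ.neg h.1⟩

end Hyperbolic

end GenSignedMeasure

/-! ### Extended-real values and the theorem -/

/-- For `v = ∞` the hypothesis forces `a` or `b` to vanish, excluding `∞ - ∞`; if both vanish, each
side is 0 by the convention `0 * ∞ = 0`. -/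
lemma EReal.coe_ennreal_mul_sub_coe_ennreal_mul (a b : ℝ≥0) (v : ℝ≥0∞)
    (h : (a : ℝ≥0∞) * v ≠ ∞ ∨ (b : ℝ≥0∞) * v ≠ ∞) :
    (((a : ℝ≥0∞) * v : ℝ≥0∞) : EReal) - (((b : ℝ≥0∞) * v : ℝ≥0∞) : EReal)
      = (((a : ℝ) - b : ℝ) : EReal) * (v : EReal) := by
  rcases eq_or_ne v ∞ with rfl | hv
  · rcases eq_or_ne a 0 with rfl | ha
    · rcases eq_or_ne b 0 with rfl | hb
      · simp
      · have hb' : ((b : ℝ≥0∞)) ≠ 0 := by exact_mod_cast hb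
        have : (-(b : ℝ)) < 0 := by simpa using pos_iff_ne_zero.2 hb
        rw [ENNReal.mul_top hb']
        simp [EReal.coe_mul_top_of_neg this, -EReal.coe_neg]
    · have ha' : ((a : ℝ≥0∞)) ≠ 0 := by exact_mod_cast ha
      rcases eq_or_ne b 0 with rfl | hb
      · have : 0 < (a : ℝ) := by simpa using pos_iff_ne_zero.2 ha
        rw [ENNReal.mul_top ha']
        simp [EReal.coe_mul_top_of_pos this]
      · have hb' : ((b : ℝ≥0∞)) ≠ 0 := by exact_mod_cast hb
        simp [ENNReal.mul_top ha', ENNReal.mul_top hb'] at h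
  · lift v to ℝ≥0 using hv
    rw [← ENNReal.coe_mul, ← ENNReal.coe_mul]
    simp only [EReal.coe_nnreal_eq_coe_real]
    rw [← EReal.coe_sub, ← EReal.coe_mul, NNReal.coe_mul, NNReal.coe_mul,
      sub_mul]

theorem theoremt :
    -- nonnegative measures
    (∀ μ : Measure (ℍ × ℍ), DiagonallyInvariant μ →
      (∃ A : Set ℍ, IsOpen A ∧ A.Nonempty ∧ μ (A ×ˢ Set.univ) < ∞) →
      (∀ B : Set ℍ, MeasurableSet B → μ (B ×ˢ Set.univ) = μ (Set.univ ×ˢ B)) ∧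
      ∃ c : ℝ≥0, ∀ B : Set ℍ, MeasurableSet B →
        μ (B ×ˢ Set.univ) = (c : ℝ≥0∞) * volume B) ∧
    -- signed measures
    (∀ μ : GenSignedMeasure (ℍ × ℍ), μ.DiagonallyInvariant →
      (∀ K : Set ℍ, IsCompact K → μ.HasFiniteVariationOn (K ×ˢ Set.univ)) →
      (∀ B : Set ℍ, MeasurableSet B → volume B < ∞ →
        μ.totalVariation (B ×ˢ Set.univ) < ∞ ∧ μ.totalVariation (Set.univ ×ˢ B) < ∞) ∧
      (∀ B : Set ℍ, MeasurableSet B →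
        (μ.IsDefinedOn (B ×ˢ Set.univ) ↔ μ.IsDefinedOn (Set.univ ×ˢ B)) ∧
        (μ.IsDefinedOn (B ×ˢ Set.univ) →
          μ.value (B ×ˢ Set.univ) = μ.value (Set.univ ×ˢ B))) ∧
      ∃ c : ℝ, ∀ B : Set ℍ, MeasurableSet B → μ.IsDefinedOn (B ×ˢ Set.univ) →
        μ.value (B ×ˢ Set.univ) = (c : EReal) * ((volume B : ℝ≥0∞) : EReal)) := by

  refine ⟨fun μ hμ hA => ?_, fun μ hμ hK => ?_⟩
  · obtain ⟨c, hc⟩ := hμ.marginals_eq_smul_volume hA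
    exact ⟨fun B hB => (hc B hB).1.trans (hc B hB).2.symm, c, fun B hB => (hc B hB).1⟩
  · obtain ⟨a, ha⟩ := hμ.exists_upperVariation_eq hK
    -- The lower variation is the upper variation of `-μ`.
    obtain ⟨b, hb⟩ := hμ.neg.exists_upperVariation_eq fun K hKc => (hK K hKc).neg
    simp only [GenSignedMeasure.upperVariation_neg] at hb
    refine ⟨fun B hB hBv => ?_, fun B hB => ?_, a - b, fun B hB hdef => ?_⟩
    · simp only [GenSignedMeasure.totalVariation, ha B hB, hb B hB, and_self]
      exact ENNReal.add_lt_top.2 ⟨ENNReal.mul_lt_top ENNReal.coe_lt_top hBv,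
        ENNReal.mul_lt_top ENNReal.coe_lt_top hBv⟩
    · simp only [GenSignedMeasure.IsDefinedOn, GenSignedMeasure.value, ha B hB, hb B hB,
        implies_true, and_self]
    · simp only [GenSignedMeasure.IsDefinedOn, GenSignedMeasure.value, ha B hB, hb B hB]
        at hdef ⊢
      exact EReal.coe_ennreal_mul_sub_coe_ennreal_mul a b (volume B) hdef
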